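/- Let $\Bbbk$ be an algebraically closed field. A finite tensor category over $\Bbbk$ is a $\Bbbk$-linear abelian rigid monoidal category whose tensor product is $\Bbbk$-bilinear on morphisms, with $\operatorname{End}(\mathbf 1)=\Bbbk$, with finite-dimensional morphism spaces, all of whose objects have finite length, with enough projectives and with finitely many isomorphism classes of simple objects. It is semisimple if every object is a finite direct sum of simple objects. An object $X$ with dual $X^*$ is invertible if the evaluation $X^*\otimes X\to\mathbf 1$ and the coevaluation $\mathbf 1\to X\otimes X^*$ are isomorphisms. The stable category $\underline{\mathcal C}$ has the same objects as $\mathcal C$, and $\underline{\operatorname{Hom}}_{\mathcal C}(X,Y)$ is the quotient of $\operatorname{Hom}_{\mathcal C}(X,Y)$ by the subspace of morphisms that factor through a projective object. A $\Bbbk$-linear functor $F:\mathcal C\to\mathcal C'$ that sends projective objects to projective objects induces a $\Bbbk$-linear functor $\underline F:\underline{\mathcal C}\to\underline{\mathcal C'}$, $X\mapsto F(X)$, $\underline f\mapsto\underline{F(f)}$; we say that $F$ induces a stable equivalence if $F$ sends projective objects to projective objects and $\underline F$ is an equivalence. A tensor equivalence is a $\Bbbk$-linear monoidal functor that is an equivalence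 of categories. Proposition. Let $\mathcal C$ and $\mathcal C'$ be non-semisimple finite tensor categories over $\Bbbk$ in which every simple object is invertible. Suppose that $F:\mathcal C\to\mathcal C'$ is an exact $\Bbbk$-linear (strong) monoidal functor that induces a stable equivalence $\underline F:\underline{\mathcal C}\to\underline{\mathcal C'}$. Then $F$ is a tensor equivalence. -/

import Mathlib

open CategoryTheory CategoryTheory.Limits CategoryTheory.MonoidalCategory

universe w v u v' u'

noncomputable section

namespace FinTensor

open scoped ZeroObject

attribute [local instance] Abelian.hasFiniteBiproducts

/-! ### Stable categories -/

section Stable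

variable {C : Type u} [Category.{v} C]

/-- The morphism `f` factors through a projective object. -/
def FactorsThroughProjective {X Y : C} (f : X ⟶ Y) : Prop :=
  ∃ (P : C) (_ : Projective P) (i : X ⟶ P) (j : P ⟶ Y), i ≫ j = f

theorem FactorsThroughProjective.map {D : Type u'} [Category.{v'} D] {X Y : C}
    {f : X ⟶ Y} (hf : FactorsThroughProjective f) (F : C ⥤ D)
    (hF : ∀ P : C, Projective P → Projective (F.obj P)) :
    FactorsThroughProjective (F.map f) := by
  obtain ⟨P, hP, i, j, rfl⟩ := hf
  exact ⟨F.obj P, hF P hP, F.map i, F.map j, by simp⟩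

variable [Abelian C]

theorem FactorsThroughProjective.zero (X Y : C) :
    FactorsThroughProjective (0 : X ⟶ Y) :=
  ⟨0, inferInstance, 0, 0, by simp⟩

theorem FactorsThroughProjective.add {X Y : C} {f g : X ⟶ Y}
    (hf : FactorsThroughProjective f) (hg : FactorsThroughProjective g) :
    FactorsThroughProjective (f + g) := by
  obtain ⟨P, hP, i, j, rfl⟩ := hf
  obtain ⟨Q, hQ, i', j', rfl⟩ := hg
  exact ⟨P ⊞ Q, inferInstance, biprod.lift i i', biprod.desc j j', by simp⟩

theorem FactorsThroughProjective.neg {X Y : C} {f : X ⟶ Y}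
    (hf : FactorsThroughProjective f) : FactorsThroughProjective (-f) := by
  obtain ⟨P, hP, i, j, rfl⟩ := hf
  exact ⟨P, hP, i, -j, by simp⟩

theorem FactorsThroughProjective.smul {k : Type w} [Field k] [Linear k C] {X Y : C} (c : k)
    {f : X ⟶ Y} (hf : FactorsThroughProjective f) : FactorsThroughProjective (c • f) := by
  obtain ⟨P, hP, i, j, rfl⟩ := hf
  exact ⟨P, hP, i, c • j, by simp⟩

variable (C) in
/-- Two parallel morphisms are identified in the stable category when their difference factors
through a projective object. -/
def stableRel : HomRel C := fun _ _ f g => FactorsThroughProjective (f - g)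

instance : Congruence (stableRel C) where
  equivalence :=
    { refl := fun f => by simpa [stableRel] using FactorsThroughProjective.zero _ _
      symm := fun {f g} h => by simpa [stableRel] using h.neg
      trans := fun {f g h} h₁ h₂ => by simpa [stableRel] using h₁.add h₂ }
  comp_left := by
    rintro X Y Z f g g' ⟨P, hP, i, j, h⟩
    exact ⟨P, hP, f ≫ i, j, by simp [h]⟩
  comp_right := by
    rintro X Y Z f f' g ⟨P, hP, i, j, h⟩
    exact ⟨P, hP, i, j ≫ g, by rw [← Category.assoc, h, Preadditive.sub_comp]⟩

variable (C) in
/-- The stable category: the objects are those of `C`, and the morphisms from `X` to `Y` are the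
quotient of `X ⟶ Y` by the morphisms which factor through a projective object. -/
abbrev StableCategory : Type u := CategoryTheory.Quotient (stableRel C)

instance : Preadditive (StableCategory C) :=
  CategoryTheory.Quotient.preadditive (stableRel C) fun X Y f₁ f₂ g₁ g₂ h₁ h₂ => by
    have h := FactorsThroughProjective.add h₁ h₂
    rwa [sub_add_sub_comm] at h

instance : (CategoryTheory.Quotient.functor (stableRel C)).Additive where
  map_add := rfl

instance (k : Type w) [Field k] [Linear k C] : Linear k (StableCategory C) :=
  CategoryTheory.Quotient.linear k (stableRel C) fun c X Y f₁ f₂ h => by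
    have h' := FactorsThroughProjective.smul c h
    rwa [smul_sub] at h'

variable {D : Type u'} [Category.{v'} D] [Abelian D]

/-- The functor between stable categories induced by an additive functor which sends projective
objects to projective objects: it sends `X` to `F X` and the class of `f` to the class of `F f`. -/
def stableFunctor (F : C ⥤ D) [F.Additive]
    (hF : ∀ P : C, Projective P → Projective (F.obj P)) : StableCategory C ⥤ StableCategory D :=
  CategoryTheory.Quotient.lift (stableRel C) (F ⋙ CategoryTheory.Quotient.functor (stableRel D)) fun _ _ f₁ f₂ h =>
    CategoryTheory.Quotient.sound (stableRel D) (by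
      have h' := FactorsThroughProjective.map h F hF
      rwa [F.map_sub] at h')

/-- The induced functor of an additive functor is additive. -/
instance (F : C ⥤ D) [F.Additive] (hF : ∀ P : C, Projective P → Projective (F.obj P)) :
    (stableFunctor F hF).Additive where
  map_add := by
    rintro _ _ ⟨f⟩ ⟨g⟩
    exact congrArg (CategoryTheory.Quotient.functor (stableRel D)).map F.map_add

/-- The induced functor of a `k`-linear functor is `k`-linear. -/
instance (k : Type w) [Field k] [Linear k C] [Linear k D] (F : C ⥤ D) [F.Additive] [F.Linear k]
    (hF : ∀ P : C, Projective P → Projective (F.obj P)) :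
    (stableFunctor F hF).Linear k where
  map_smul := by
    rintro _ _ ⟨f⟩ c
    exact congrArg (CategoryTheory.Quotient.functor (stableRel D)).map (F.map_smul c f)

/-- `F` induces a stable equivalence: it sends projective objects to projective objects and the
induced functor between the stable categories is an equivalence. -/
def InducesStableEquivalence (F : C ⥤ D) [F.Additive] : Prop :=
  ∃ hF : ∀ P : C, Projective P → Projective (F.obj P), (stableFunctor F hF).IsEquivalence

end Stable

/-! ### Finite tensor categories -/

/-- A `k`-linear abelian category is finite if its morphism spaces are finite dimensional, all of
its objects have finite length, it has enough projectives, and it has only finitely many simple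
objects up to isomorphism. -/
class IsFiniteAbelian (k : Type w) [Field k] (C : Type u) [Category.{v} C] [Abelian C]
    [Linear k C] : Prop where
  finiteDimensional_hom : ∀ X Y : C, FiniteDimensional k (X ⟶ Y)
  finite_length : ∀ X : C, IsNoetherianObject X ∧ IsArtinianObject X
  enoughProjectives : EnoughProjectives C
  finite_simples : ∃ s : Set C, s.Finite ∧ ∀ X : C, Simple X → ∃ Y ∈ s, Nonempty (X ≅ Y)

/-- A finite tensor category over `k`: a finite `k`-linear abelian rigid monoidal category whose
tensor product is `k`-bilinear on morphisms and whose unit object satisfies `End 𝟙 = k`. -/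
class IsFiniteTensorCategory (k : Type w) [Field k] (C : Type u) [Category.{v} C] [Abelian C]
    [Linear k C] [MonoidalCategory C] [MonoidalPreadditive C] [MonoidalLinear k C]
    [RigidCategory C] : Prop extends IsFiniteAbelian k C where
  end_unit : Function.Bijective fun c : k => c • 𝟙 (𝟙_ C)

/-- A category is semisimple if every object is a finite direct sum of simple objects. -/
def IsSemisimpleCategory (C : Type u) [Category.{v} C] [Abelian C] : Prop :=
  ∀ X : C, ∃ (n : ℕ) (S : Fin n → C), (∀ i, Simple (S i)) ∧ Nonempty (X ≅ ⨁ S)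

/-- An object `X` with dual `X*` is invertible if the evaluation `X* ⊗ X ⟶ 𝟙` and the coevaluation
`𝟙 ⟶ X ⊗ X*` are isomorphisms. (The dual with these structure maps, often called the left dual, is
named `Xᘁ` in Mathlib.) -/
def IsInvertibleObject {C : Type u} [Category.{v} C] [MonoidalCategory C] [RigidCategory C]
    (X : C) : Prop :=
  IsIso (ε_ X (Xᘁ)) ∧ IsIso (η_ X (Xᘁ))

/-- A tensor equivalence is a `k`-linear (strong) monoidal functor which is an equivalence of
categories. Linearity and the monoidal structure of `F` are instance arguments; the property to be
checked is that the underlying functor is an equivalence. -/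
def IsTensorEquivalence (k : Type w) [Field k]
    {C : Type u} [Category.{v} C] [Abelian C] [Linear k C] [MonoidalCategory C]
    {D : Type u'} [Category.{v'} D] [Abelian D] [Linear k D] [MonoidalCategory D]
    (F : C ⥤ D) [F.Additive] [F.Linear k] [F.Monoidal] : Prop :=
  F.IsEquivalence

end FinTensor

end

/-! The category `C` is rigid, so tensoring is exact and preserves projectives and injectives. Two
consequences carry the proof. Projectives are injective (`injective_of_projective`), so Ext¹(X, Y)
is the stable Hom from the syzygy of X to Y. Stable faithfulness of `F` therefore makes `F`
injective on Ext¹. Concretely, a morphism extends along a monomorphism, or lifts along an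
epimorphism, as soon as its image under `F` does (`exists_extension`, `exists_lift`). In the target,
an invertible projective simple object would make the unit, hence every object, projective. So no
simple object there is projective, and Hom between simples equals stable Hom. A monoidal functor
preserves invertibility, so `F` sends simples to simples. Being exact, it is faithful; by stable
fullness it is full on simples. Injectivity on Ext¹ spreads fullness to all objects by a four-lemma
argument along composition series (`full_of_simple`). Every simple object of the target is some
`F.obj S` (`exists_iso_of_simple`), so every object is the cokernel of a map between images of
projectives, and fullness puts that map in the image of `F` (`essSurj_of_simple`). -/

noncomputable section

namespace FinTensor

open scoped ZeroObject

/-! ### Objects of finite length -/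

section FiniteLength

variable {C : Type u} [Category.{v} C] [Abelian C]

/-- Induction on objects of finite length: a property which holds for zero objects and passes from
a subobject with simple quotient to the whole object holds for every object. -/
theorem finiteLength_induction (hfin : ∀ X : C, IsNoetherianObject X ∧ IsArtinianObject X)
    {P : C → Prop} (zero : ∀ X : C, IsZero X → P X)
    (step : ∀ S : ShortComplex C, S.ShortExact → P S.X₁ → Simple S.X₃ → P S.X₂) (X : C) :
    P X := by
  have := (hfin X).1
  -- `P` is not assumed invariant under isomorphism, hence the quantification over all `Y`
  -- isomorphic to `A`.
  obtain ⟨A, hA, hmax⟩ := (wellFounded_gt (α := Subobject X)).has_min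
    {A : Subobject X | ∀ Y : C, Nonempty ((A : C) ≅ Y) → P Y}
    ⟨⊥, fun Y ⟨e⟩ => zero _ (((isZero_zero C).of_iso Subobject.botCoeIsoZero).of_iso e.symm)⟩
  by_cases htop : A = ⊤
  · subst htop
    exact hA X ⟨asIso (⊤ : Subobject X).arrow⟩
  exfalso
  have hne : ¬ IsZero (cokernel A.arrow) := fun hz => htop (by
    have : Epi A.arrow := Preadditive.epi_of_isZero_cokernel _ hz
    have : IsIso A.arrow := isIso_of_mono_of_epi _
    exact Subobject.eq_top_of_isIso_arrow A)
  have := (hfin (cokernel A.arrow)).2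
  obtain ⟨T, hT⟩ := exists_simple_subobject hne
  -- The preimage in `X` of a simple subobject `T` of `X / A` is strictly larger than `A`, with
  -- simple quotient `T`.
  let f : pullback (cokernel.π A.arrow) T.arrow ⟶ X := pullback.fst _ _
  let g : pullback (cokernel.π A.arrow) T.arrow ⟶ (T : C) := pullback.snd _ _
  have hfg : f ≫ cokernel.π A.arrow = g ≫ T.arrow := pullback.condition
  let u : (A : C) ⟶ pullback (cokernel.π A.arrow) T.arrow :=
    pullback.lift A.arrow 0 (by simp)
  have huf : u ≫ f = A.arrow := pullback.lift_fst _ _ _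
  have hug : u ≫ g = 0 := pullback.lift_snd _ _ _
  have : Mono u := mono_of_mono_fac huf
  have hle : A ≤ Subobject.mk f := Subobject.le_mk_of_comm u huf
  refine hmax (Subobject.mk f) ?_ (lt_of_le_of_ne hle fun h => ?_)
  · rintro Y ⟨e⟩
    let e' := Subobject.underlyingIso f
    refine step (ShortComplex.mk (u ≫ e'.inv ≫ e.hom) (e.inv ≫ e'.hom ≫ g) (by simp [hug]))
      (ShortComplex.ShortExact.mk' ?_ (by dsimp; infer_instance) (by dsimp; infer_instance))
      (hA _ ⟨Iso.refl _⟩) hT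
    refine ShortComplex.exact_of_f_is_kernel _ (KernelFork.IsLimit.ofι' _ _ fun {W} k hk => ?_)
    have hk' : (k ≫ e.inv ≫ e'.hom ≫ f) ≫ cokernel.π A.arrow = 0 := by
      have hk0 : k ≫ e.inv ≫ e'.hom ≫ g = 0 := hk
      simp only [Category.assoc, hfg]
      simpa using congrArg (· ≫ T.arrow) hk0
    refine ⟨(ShortComplex.exact_cokernel A.arrow).lift _ hk', ?_⟩
    have hl := (ShortComplex.exact_cokernel A.arrow).lift_f _ hk'
    dsimp at hl ⊢
    rw [← cancel_mono e.inv, ← cancel_mono e'.hom, ← cancel_mono f]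
    simpa [huf] using hl
  · have hg : g = 0 := by
      rw [← cancel_mono T.arrow, ← hfg, zero_comp]
      have : f = (Subobject.underlyingIso f).inv ≫ Subobject.ofLE _ _ h.ge ≫ A.arrow := by simp
      rw [this, Category.assoc, Category.assoc, cokernel.condition, comp_zero, comp_zero]
    exact Simple.not_isZero (T : C) (IsZero.of_epi_eq_zero g hg)

theorem exists_simple (hfin : ∀ X : C, IsNoetherianObject X ∧ IsArtinianObject X)
    (X : C) (hX : ¬ IsZero X) : ∃ (S : C) (_ : Simple S) (i : S ⟶ X), Mono i :=
  have := (hfin X).2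
  ⟨simpleSubobject hX, inferInstance, simpleSubobjectArrow hX, inferInstance⟩

attribute [local instance] Abelian.hasFiniteBiproducts

/-- A system of orthogonal injections and projections identifies an object with a direct sum. -/
def isoBiproduct {n : ℕ} {T : Fin n → C} {X : C} (p : ∀ i, X ⟶ T i) (q : ∀ i, T i ⟶ X)
    (h : ∀ i, q i ≫ p i = 𝟙 _) (h' : ∀ i j, i ≠ j → q i ≫ p j = 0)
    (hsum : ∑ i, p i ≫ q i = 𝟙 X) : X ≅ ⨁ T where
  hom := biproduct.lift p
  inv := biproduct.desc q
  hom_inv_id := by rw [biproduct.lift_desc, hsum]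
  inv_hom_id := by
    ext j i
    by_cases hij : i = j
    · subst hij
      simp [h]
    · simp [h' i j hij, biproduct.ι_π_ne _ hij]

/-- Every short exact sequence splits, so each simple quotient peels off as a direct summand. -/
theorem isSemisimpleCategory_of_projective
    (hfin : ∀ X : C, IsNoetherianObject X ∧ IsArtinianObject X)
    (h : ∀ X : C, Projective X) : IsSemisimpleCategory C := by
  refine finiteLength_induction hfin (fun X hX => ?_) (fun S hS h₁ h₃ => ?_)
  · exact ⟨0, Fin.elim0, fun i => i.elim0,
      ⟨isoBiproduct (fun i => i.elim0) (fun i => i.elim0) (fun i => i.elim0) (fun i => i.elim0)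
        (hX.eq_of_src _ _)⟩⟩
  · obtain ⟨n, T, hT, ⟨e⟩⟩ := h₁
    have := h S.X₃
    let σ := hS.splittingOfProjective
    have hsum : ∑ i, (σ.r ≫ e.hom ≫ biproduct.π T i) ≫ biproduct.ι T i ≫ e.inv ≫ S.f =
        σ.r ≫ S.f := by
      have h₁ := congrArg (fun t => σ.r ≫ e.hom ≫ t ≫ e.inv ≫ S.f) (biproduct.total (f := T))
      simpa only [Preadditive.sum_comp, Preadditive.comp_sum, Category.assoc, Category.id_comp,
        Iso.hom_inv_id_assoc] using h₁
    refine ⟨n + 1, Fin.cons S.X₃ T, fun i => Fin.cases h₃ hT i,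
      ⟨isoBiproduct (fun i => Fin.cases S.g (fun i => σ.r ≫ e.hom ≫ biproduct.π T i) i)
        (fun i => Fin.cases σ.s (fun i => biproduct.ι T i ≫ e.inv ≫ S.f) i) ?_ ?_ ?_⟩⟩
    · refine Fin.cases σ.s_g fun i => ?_
      change (biproduct.ι T i ≫ e.inv ≫ S.f) ≫ σ.r ≫ e.hom ≫ biproduct.π T i = 𝟙 (T i)
      simp
    · refine Fin.cases (Fin.cases (fun hij => (hij rfl).elim) fun j _ => ?_)
        (fun i => Fin.cases (fun _ => ?_) fun j hij => ?_)
      · change σ.s ≫ σ.r ≫ e.hom ≫ biproduct.π T j = 0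
        simp
      · change (biproduct.ι T i ≫ e.inv ≫ S.f) ≫ S.g = 0
        simp
      · change (biproduct.ι T i ≫ e.inv ≫ S.f) ≫ σ.r ≫ e.hom ≫ biproduct.π T j = 0
        simp [biproduct.ι_π_ne T fun hij' => hij (congrArg Fin.succ hij')]
    · rw [Fin.sum_univ_succ]
      exact (congrArg (S.g ≫ σ.s + ·) hsum).trans ((add_comm _ _).trans σ.id)

end FiniteLength

/-! ### Rigid abelian categories -/

section Rigid

variable {C : Type u} [Category.{v} C] [MonoidalCategory C] [RigidCategory C]

/-- Left and right duals make each tensor functor a left and a right adjoint, and its adjoints are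
again tensor functors. Hence all of them are exact and preserve projectives and injectives. -/
instance (X : C) : (tensorLeft X).IsLeftAdjoint :=
  (tensorLeftAdjunction (ᘁX) X).isLeftAdjoint

instance (X : C) : (tensorLeft X).IsRightAdjoint :=
  (tensorLeftAdjunction X (Xᘁ)).isRightAdjoint

instance (X : C) : (tensorRight X).IsLeftAdjoint :=
  (tensorRightAdjunction X (Xᘁ)).isLeftAdjoint

instance (X : C) : (tensorRight X).IsRightAdjoint :=
  (tensorRightAdjunction (ᘁX) X).isRightAdjoint

theorem projective_tensor_left (X P : C) (hP : Projective P) : Projective (X ⊗ P) :=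
  Adjunction.map_projective (tensorLeftAdjunction (ᘁX) X) P hP

theorem projective_tensor_right (P X : C) (hP : Projective P) : Projective (P ⊗ X) :=
  Adjunction.map_projective (tensorRightAdjunction X (Xᘁ)) P hP

theorem injective_tensor_left (X J : C) (hJ : Injective J) : Injective (X ⊗ J) :=
  Adjunction.map_injective (tensorLeftAdjunction X (Xᘁ)) J hJ

theorem injective_tensor_right (J X : C) (hJ : Injective J) : Injective (J ⊗ X) :=
  Adjunction.map_injective (tensorRightAdjunction (ᘁX) X) J hJ

theorem projective_of_projective_unit (h : Projective (𝟙_ C)) (X : C) : Projective X :=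
  Projective.of_iso (ρ_ X) (projective_tensor_left X _ h)

variable [Abelian C] [MonoidalPreadditive C]

/-- The dual of a projective object is injective. -/
theorem injective_rightDual (P : C) (hP : Projective P) : Injective (Pᘁ) := by
  refine Injective.of_iso (λ_ (Pᘁ)) ⟨fun {A B} g i _ => ?_⟩
  -- `cokernel i ⊗ P` is projective, so `i ▷ P` is split. Extending a map to `Pᘁ` along `i` amounts
  -- to extending a map to the unit along `i ▷ P`.
  obtain ⟨r, hr⟩ : ∃ r : B ⊗ P ⟶ A ⊗ P, i ▷ P ≫ r = 𝟙 _ := by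
    have hS := (ShortComplex.ShortExact.mk' (ShortComplex.exact_cokernel i) ‹_›
      inferInstance).map_of_exact (tensorRight P)
    have : Projective (cokernel i ⊗ P) := projective_tensor_left (cokernel i) P hP
    have : Projective ((ShortComplex.mk i (cokernel.π i) (by simp)).map (tensorRight P)).X₃ := this
    exact ⟨_, hS.splittingOfProjective.f_r⟩
  let e (X : C) := tensorRightHomEquiv X P (Pᘁ) (𝟙_ C)
  refine ⟨e B (r ≫ (e A).symm g), (e A).symm.injective ?_⟩
  rw [tensorRightHomEquiv_symm_naturality, Equiv.symm_apply_apply, ← Category.assoc, hr,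
    Category.id_comp]

/-- An object `P` with dual `P*` is a retract of `P ⊗ (P* ⊗ P)`. -/
def retractTensorDual (P : C) : Retract P (P ⊗ (Pᘁ ⊗ P)) where
  i := (λ_ P).inv ≫ η_ P (Pᘁ) ▷ P ≫ (α_ _ _ _).hom
  r := P ◁ ε_ P (Pᘁ) ≫ (ρ_ P).hom
  retract := by simp

theorem injective_of_projective (P : C) (hP : Projective P) : Injective P :=
  have := injective_tensor_left P _ (injective_tensor_right _ P (injective_rightDual P hP))
  (retractTensorDual P).injective

end Rigid

/-! ### Invertible objects -/

section Invertible

variable {C : Type u} [Category.{v} C] [MonoidalCategory C]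

/-- Tensoring on the right with an object that has a two-sided inverse is an equivalence. -/
def tensorRightEquivalence {X Y : C} (e : X ⊗ Y ≅ 𝟙_ C) (e' : Y ⊗ X ≅ 𝟙_ C) : C ≌ C :=
  CategoryTheory.Equivalence.mk (tensorRight X) (tensorRight Y)
    (NatIso.ofComponents (fun Z => (ρ_ Z).symm ≪≫ whiskerLeftIso Z e.symm ≪≫ (α_ _ _ _).symm)
      (fun {Z W} f => by
        dsimp
        rw [whiskerLeftIso_hom, whiskerLeftIso_hom, rightUnitor_inv_naturality_assoc, Category.assoc, Category.assoc,
          ← associator_inv_naturality_left, whisker_exchange_assoc]))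
    (NatIso.ofComponents (fun Z => α_ _ _ _ ≪≫ whiskerLeftIso Z e' ≪≫ ρ_ Z)
      (fun {Z W} f => by
        dsimp
        rw [whiskerLeftIso_hom, whiskerLeftIso_hom, Category.assoc, Category.assoc, ← rightUnitor_naturality, whisker_exchange_assoc,
          associator_naturality_left_assoc]))

/-- The structure isomorphisms of an invertible object. -/
theorem IsInvertibleObject.exists_iso [RigidCategory C] {X : C} (h : IsInvertibleObject X) :
    ∃ Y : C, Nonempty (X ⊗ Y ≅ 𝟙_ C) ∧ Nonempty (Y ⊗ X ≅ 𝟙_ C) :=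
  have := h.1
  have := h.2
  ⟨Xᘁ, ⟨(asIso (η_ X (Xᘁ))).symm⟩, ⟨asIso (ε_ X (Xᘁ))⟩⟩

variable [Abelian C]

/-- If some object with a two-sided inverse is simple, then all of them are. -/
theorem simple_iff_unit {X Y : C} (e : X ⊗ Y ≅ 𝟙_ C) (e' : Y ⊗ X ≅ 𝟙_ C) :
    Simple X ↔ Simple (𝟙_ C) := by
  rw [← simple_obj_iff (tensorRightEquivalence e e').functor (𝟙_ C)]
  exact Simple.iff_of_iso (λ_ X).symm

end Invertible

/-! ### Categories whose simple objects are all invertible -/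

section Pointed

variable {C : Type u} [Category.{v} C] [Abelian C] [MonoidalCategory C] [RigidCategory C]

theorem not_projective_of_simple
    (hfin : ∀ X : C, IsNoetherianObject X ∧ IsArtinianObject X)
    (hC : ¬ IsSemisimpleCategory C) (hinv : ∀ X : C, Simple X → IsInvertibleObject X)
    (S : C) (hS : Simple S) : ¬ Projective S := fun hP => by
  obtain ⟨Y, ⟨e⟩, -⟩ := (hinv S hS).exists_iso
  exact hC (isSemisimpleCategory_of_projective hfin (projective_of_projective_unit
    (Projective.of_iso e (projective_tensor_right S Y hP))))

/-- Some object is nonzero, so a simple `S` exists; the autoequivalence of tensoring with `S`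
carries the unit to `S`. -/
theorem simple_unit (hfin : ∀ X : C, IsNoetherianObject X ∧ IsArtinianObject X)
    (hC : ¬ IsSemisimpleCategory C) (hinv : ∀ X : C, Simple X → IsInvertibleObject X) :
    Simple (𝟙_ C) := by
  have h : ∃ X : C, ¬ IsZero X := by
    by_contra! h
    exact hC (isSemisimpleCategory_of_projective hfin fun X => (h X).projective)
  obtain ⟨X, hX⟩ := h
  obtain ⟨S, hS, -⟩ := exists_simple hfin X hX
  obtain ⟨Y, ⟨e⟩, ⟨e'⟩⟩ := (hinv S hS).exists_iso
  exact (simple_iff_unit e e').1 hS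

end Pointed

/-! ### Morphisms in the stable category -/

section StableMorphisms

variable {C : Type u} [Category.{v} C]

theorem FactorsThroughProjective.postcomp {X Y Z : C} {f : X ⟶ Y}
    (hf : FactorsThroughProjective f) (g : Y ⟶ Z) : FactorsThroughProjective (f ≫ g) := by
  obtain ⟨P, hP, i, j, rfl⟩ := hf
  exact ⟨P, hP, i, j ≫ g, by simp⟩

theorem FactorsThroughProjective.projective {X : C} (h : FactorsThroughProjective (𝟙 X)) :
    Projective X := by
  obtain ⟨P, hP, i, j, h⟩ := h
  exact (Retract.mk i j h).projective

variable [Abelian C]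

/-- Between nonprojective simple objects, only the zero morphism is stably zero. -/
theorem FactorsThroughProjective.eq_zero {S T : C} [Simple S] [Simple T] (hS : ¬ Projective S)
    {f : S ⟶ T} (hf : FactorsThroughProjective f) : f = 0 := by
  by_contra h
  have := isIso_of_hom_simple h
  exact hS (FactorsThroughProjective.projective (by simpa using hf.postcomp (inv f)))

/-- An object all of whose morphisms to simple objects are stably zero is projective. -/
theorem projective_of_forall_simple (hfin : ∀ X : C, IsNoetherianObject X ∧ IsArtinianObject X)
    (X : C) (h : ∀ (S : C), Simple S → ∀ f : X ⟶ S, FactorsThroughProjective f) :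
    Projective X := by
  refine FactorsThroughProjective.projective ?_
  suffices ∀ (Y : C) (f : X ⟶ Y), FactorsThroughProjective f from this X _
  refine finiteLength_induction hfin (fun Y hY f => ?_) (fun S hS h₁ h₃ f => ?_)
  · rw [hY.eq_zero_of_tgt f]
    exact .zero _ _
  -- Lifting `j` through `S.g` corrects `f` by a stably zero map; the difference lands in `S.X₁`.
  · obtain ⟨P, hP, i, j, hij⟩ := h _ h₃ (f ≫ S.g)
    have := hS.epi_g
    have := hS.mono_f
    have hw : (f - i ≫ Projective.factorThru j S.g) ≫ S.g = 0 := by simp [hij]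
    have hl := hS.exact.lift_f _ hw
    have h₂ := (h₁ (hS.exact.lift _ hw)).postcomp S.f
    rw [hl] at h₂
    simpa using h₂.add ⟨P, hP, i, Projective.factorThru j S.g, rfl⟩

variable {D : Type u'} [Category.{v'} D] [Abelian D] (F : C ⥤ D) [F.Additive]

section Equivalence

variable (hP : ∀ P : C, Projective P → Projective (F.obj P))

/-- This is the only form in which stable faithfulness enters the lifting lemmas, as their
hypothesis `hfaith`. -/
theorem FactorsThroughProjective.of_map [(stableFunctor F hP).Faithful] {X Y : C} {f : X ⟶ Y}
    (hf : FactorsThroughProjective (F.map f)) : FactorsThroughProjective f := by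
  have h : (CategoryTheory.Quotient.functor (stableRel C)).map f = (CategoryTheory.Quotient.functor (stableRel C)).map 0 := by
    apply (stableFunctor F hP).map_injective
    refine CategoryTheory.Quotient.sound (stableRel D) ?_
    simpa [stableRel] using hf
  simpa [stableRel] using (CategoryTheory.Quotient.functor_map_eq_iff _ _ _).1 h

theorem exists_map_sub_factorsThroughProjective [(stableFunctor F hP).Full] {X Y : C}
    (g : F.obj X ⟶ F.obj Y) : ∃ f : X ⟶ Y, FactorsThroughProjective (F.map f - g) := by
  obtain ⟨f, hf⟩ := (stableFunctor F hP).map_surjective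
    (X := (CategoryTheory.Quotient.functor (stableRel C)).obj X) (Y := (CategoryTheory.Quotient.functor (stableRel C)).obj Y)
    ((CategoryTheory.Quotient.functor (stableRel D)).map g)
  obtain ⟨f, rfl⟩ := (CategoryTheory.Quotient.functor (stableRel C)).map_surjective f
  exact ⟨f, (CategoryTheory.Quotient.functor_map_eq_iff (stableRel D) _ _).1 hf⟩

theorem exists_stable_iso [(stableFunctor F hP).EssSurj] (T : D) :
    ∃ (X : C) (a : F.obj X ⟶ T) (b : T ⟶ F.obj X),
      FactorsThroughProjective (a ≫ b - 𝟙 _) ∧ FactorsThroughProjective (b ≫ a - 𝟙 _) := by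
  obtain ⟨⟨X⟩, ⟨e⟩⟩ := ‹(stableFunctor F hP).EssSurj›.mem_essImage
    ((CategoryTheory.Quotient.functor (stableRel D)).obj T)
  obtain ⟨a, ha⟩ := (CategoryTheory.Quotient.functor (stableRel D)).map_surjective (X := F.obj X) (Y := T) e.hom
  obtain ⟨b, hb⟩ := (CategoryTheory.Quotient.functor (stableRel D)).map_surjective (X := T) (Y := F.obj X) e.inv
  refine ⟨X, a, b, (CategoryTheory.Quotient.functor_map_eq_iff (stableRel D) _ _).1 ?_,
    (CategoryTheory.Quotient.functor_map_eq_iff (stableRel D) _ _).1 ?_⟩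
  · rw [Functor.map_comp, ha, hb]
    exact e.hom_inv_id
  · rw [Functor.map_comp, ha, hb]
    exact e.inv_hom_id

end Equivalence

/-! ### Lifting along an exact functor which reflects stably zero morphisms -/

section Lifting

omit [F.Additive]

variable [PreservesFiniteLimits F] [PreservesFiniteColimits F]

theorem exists_lift_map {Z : ShortComplex C} (hZ : Z.ShortExact) {W : D} (t : W ⟶ F.obj Z.X₂)
    (ht : t ≫ F.map Z.g = 0) : ∃ l : W ⟶ F.obj Z.X₁, l ≫ F.map Z.f = t :=
  have := F.additive_of_preserves_binary_products
  have h := hZ.map_of_exact F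
  have := h.mono_f
  ⟨h.exact.lift t ht, h.exact.lift_f t ht⟩

theorem exists_desc_map {Z : ShortComplex C} (hZ : Z.ShortExact) {W : D} (t : F.obj Z.X₂ ⟶ W)
    (ht : F.map Z.f ≫ t = 0) : ∃ l : F.obj Z.X₃ ⟶ W, F.map Z.g ≫ l = t :=
  have := F.additive_of_preserves_binary_products
  have h := hZ.map_of_exact F
  have := h.epi_g
  ⟨h.exact.desc t ht, h.exact.g_desc t ht⟩

end Lifting

variable [EnoughProjectives C] (hP : ∀ P : C, Projective P → Projective (F.obj P))
  (hinj : ∀ P : C, Projective P → Injective P)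
  (hfaith : ∀ {X Y : C} (f : X ⟶ Y),
    FactorsThroughProjective (F.map f) → FactorsThroughProjective f)

include hP hinj hfaith

omit [Abelian D] [F.Additive] in
/-- A morphism extends along a monomorphism if its image under `F` does. -/
theorem exists_extension {X' X Y : C} (i : X' ⟶ X) [Mono i] (a : X' ⟶ Y)
    (g : F.obj X ⟶ F.obj Y) (hg : F.map i ≫ g = F.map a) : ∃ b : X ⟶ Y, i ≫ b = a := by
  let q := Projective.π X
  -- This pullback is the kernel of `Projective.over X ⟶ cokernel i`, a syzygy of `cokernel i`. The
  -- stable class of `t ≫ a` is the obstruction to extending `a`; its image under `F` vanishes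
  -- because of `g`.
  let s : pullback q i ⟶ _ := pullback.fst q i
  let t : pullback q i ⟶ X' := pullback.snd q i
  have hst : s ≫ q = t ≫ i := pullback.condition
  obtain ⟨Q, hQ, c, d, hcd⟩ := hfaith (t ≫ a)
    ⟨_, hP _ (Projective.projective_over X), F.map s, F.map q ≫ g, by
      rw [F.map_comp, ← hg, ← Category.assoc, ← Category.assoc, ← F.map_comp, ← F.map_comp, hst]⟩
  -- As `Q` is injective, `c` extends along the monomorphism `s`.
  have := hinj Q hQ
  let b₀ := Injective.factorThru c s ≫ d
  have hb₀ : s ≫ b₀ = t ≫ a := by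
    rw [← hcd, ← Category.assoc, Injective.comp_factorThru]
  have hk : kernel.ι q ≫ b₀ = 0 := by
    have h₁ : pullback.lift (kernel.ι q) 0 (by simp) ≫ s = kernel.ι q := pullback.lift_fst _ _ _
    have h₂ : pullback.lift (kernel.ι q) 0 (by simp) ≫ t = 0 := pullback.lift_snd _ _ _
    rw [← h₁, Category.assoc, hb₀, ← Category.assoc, h₂, zero_comp]
  refine ⟨Abelian.epiDesc q b₀ hk, ?_⟩
  rw [← cancel_epi t, ← hb₀, ← Category.assoc, ← hst, Category.assoc, Abelian.comp_epiDesc]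

variable [PreservesFiniteLimits F] [PreservesFiniteColimits F]

/-- A morphism lifts along an epimorphism if its image under `F` does. -/
theorem exists_lift {X Y Y' : C} (p : Y ⟶ Y') [Epi p] (c : X ⟶ Y')
    (g : F.obj X ⟶ F.obj Y) (hg : g ≫ F.map p = F.map c) : ∃ b : X ⟶ Y, b ≫ p = c := by
  let q := Projective.π X
  let r := Projective.factorThru (q ≫ c) p
  have hr : r ≫ p = q ≫ c := Projective.factorThru_comp _ _
  let t : kernel q ⟶ kernel p := kernel.lift p (kernel.ι q ≫ r) (by simp [hr])
  have ht : t ≫ kernel.ι p = kernel.ι q ≫ r := kernel.lift_ι _ _ _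
  have hw : (F.map r - F.map q ≫ g) ≫ F.map p = 0 := by
    rw [Preadditive.sub_comp, Category.assoc, hg, ← F.map_comp, ← F.map_comp, hr, sub_self]
  -- The lift `r` need not descend to `X`: on `kernel q` it restricts to `t`. The map `l` extends
  -- `F.map t` to `F.obj (Projective.over X)`, so `t` itself extends, and subtracting that extension
  -- makes `r` descend.
  obtain ⟨l, hl⟩ := exists_lift_map F
    (ShortComplex.ShortExact.mk' (ShortComplex.exact_kernel p) inferInstance ‹_›) _ hw
  dsimp at l hl
  obtain ⟨b, hb⟩ := exists_extension F hP hinj hfaith (kernel.ι q) t l (by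
    rw [← cancel_mono (F.map (kernel.ι p)), Category.assoc, hl, ← F.map_comp, ht,
      Preadditive.comp_sub, ← Category.assoc, ← F.map_comp, ← F.map_comp]
    simp)
  have hk : kernel.ι q ≫ (r - b ≫ kernel.ι p) = 0 := by
    rw [Preadditive.comp_sub, ← Category.assoc, hb, ht, sub_self]
  refine ⟨Abelian.epiDesc q _ hk, ?_⟩
  rw [← cancel_epi q, ← Category.assoc, Abelian.comp_epiDesc]
  simp [hr]

/-- Fullness may be checked on simple objects. -/
theorem full_of_simple (hfin : ∀ X : C, IsNoetherianObject X ∧ IsArtinianObject X)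
    (hsimple : ∀ (S T : C), Simple S → Simple T → Function.Surjective (F.map (X := S) (Y := T))) :
    F.Full := by
  suffices ∀ X Y : C, Function.Surjective (F.map (X := X) (Y := Y)) from ⟨fun {X Y} => this X Y⟩
  have h₁ (S : C) (hS : Simple S) : ∀ Y : C, Function.Surjective (F.map (X := S) (Y := Y)) := by
    refine finiteLength_induction hfin
      (fun Y hY g => ⟨0, (F.map_isZero hY).eq_of_tgt _ _⟩) (fun Z hZ h₁ h₃ g => ?_)
    have := hZ.mono_f
    have := hZ.epi_g
    obtain ⟨c, hc⟩ := hsimple S _ hS h₃ (g ≫ F.map Z.g)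
    obtain ⟨b, rfl⟩ := exists_lift F hP hinj hfaith Z.g c g hc.symm
    have hw : (g - F.map b) ≫ F.map Z.g = 0 := by
      rw [Preadditive.sub_comp, ← F.map_comp, hc, sub_self]
    obtain ⟨l, hl⟩ := exists_lift_map F hZ _ hw
    obtain ⟨d, rfl⟩ := h₁ l
    refine ⟨d ≫ Z.f + b, ?_⟩
    rw [F.map_add, F.map_comp, hl, sub_add_cancel]
  intro X Y
  revert X
  refine finiteLength_induction hfin
    (fun X hX g => ⟨0, (F.map_isZero hX).eq_of_src _ _⟩) (fun Z hZ h h₃ g => ?_)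
  have := hZ.mono_f
  have := hZ.epi_g
  obtain ⟨a, ha⟩ := h (F.map Z.f ≫ g)
  obtain ⟨b, rfl⟩ := exists_extension F hP hinj hfaith Z.f a g ha.symm
  have hw : F.map Z.f ≫ (g - F.map b) = 0 := by
    rw [Preadditive.comp_sub, ← F.map_comp, ha, sub_self]
  obtain ⟨l, hl⟩ := exists_desc_map F hZ _ hw
  obtain ⟨d, rfl⟩ := h₁ _ h₃ Y l
  refine ⟨Z.g ≫ d + b, ?_⟩
  rw [F.map_add, F.map_comp, hl, sub_add_cancel]

end StableMorphisms

/-! ### Faithfulness and essential surjectivity tested on simple objects -/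

section EssSurj

variable {C : Type u} [Category.{v} C] [Abelian C] {D : Type u'} [Category.{v'} D] [Abelian D]
  (F : C ⥤ D) [F.Additive] [PreservesFiniteLimits F] [PreservesFiniteColimits F]

/-- An exact functor which does not annihilate simple objects is faithful. -/
theorem faithful_of_simple (hfin : ∀ X : C, IsNoetherianObject X ∧ IsArtinianObject X)
    (h : ∀ S : C, Simple S → ¬ IsZero (F.obj S)) : F.Faithful := by
  have key {X Y : C} (f : X ⟶ Y) (hf : F.map f = 0) : f = 0 := by
    by_contra hne
    have hI : ¬ IsZero (image f) := fun hI => hne (by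
      rw [← image.fac f, hI.eq_of_src (image.ι f) 0, comp_zero])
    obtain ⟨S, hS, i, _⟩ := exists_simple hfin _ hI
    have h₀ : F.map (factorThruImage f) ≫ F.map (image.ι f) = 0 := by
      rw [← F.map_comp, image.fac, hf]
    have h₁ : F.map (image.ι f) = 0 := by
      rwa [← cancel_epi (F.map (factorThruImage f)), comp_zero]
    have h₂ : F.map (i ≫ image.ι f) = 0 := by rw [F.map_comp, h₁, comp_zero]
    exact h S hS (IsZero.of_mono_eq_zero _ h₂)
  refine ⟨fun {X Y f g} hfg => sub_eq_zero.1 (key _ ?_)⟩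
  rw [F.map_sub, hfg, sub_self]

/-- A full exact functor is essentially surjective if every simple object is in its image. -/
theorem essSurj_of_simple [EnoughProjectives C] [F.Full]
    (hfin : ∀ X : D, IsNoetherianObject X ∧ IsArtinianObject X)
    (hP : ∀ P : C, Projective P → Projective (F.obj P))
    (h : ∀ T : D, Simple T → ∃ S : C, Nonempty (F.obj S ≅ T)) : F.EssSurj := by
  have hcover : ∀ M : D, ∃ (P : C) (_ : Projective P) (p : F.obj P ⟶ M), Epi p := by
    refine finiteLength_induction hfin (fun M hM => ?_) (fun Z hZ h₁ h₃ => ?_)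
    · exact ⟨0, inferInstance, 0, ⟨fun _ _ _ => hM.eq_of_src _ _⟩⟩
    · have := hZ.epi_g
      obtain ⟨P, hP', p, hp⟩ := h₁
      obtain ⟨S, ⟨e⟩⟩ := h _ h₃
      have := hP _ (Projective.projective_over S)
      let q : F.obj (Projective.over S) ⟶ Z.X₂ :=
        Projective.factorThru (F.map (Projective.π S) ≫ e.hom) Z.g
      have hq : q ≫ Z.g = F.map (Projective.π S) ≫ e.hom := Projective.factorThru_comp _ _
      -- As in the horseshoe lemma, covers of the two ends combine into a cover of the middle.
      refine ⟨P ⊞ Projective.over S, inferInstance,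
        (F.map biprod.fst ≫ p ≫ Z.f + F.map biprod.snd ≫ q : F.obj _ ⟶ _), ?_⟩
      refine Preadditive.epi_of_cancel_zero _ fun {W} t ht => ?_
      have h₁ : p ≫ Z.f ≫ t = 0 := by
        simpa [← F.map_comp_assoc] using congrArg (F.map biprod.inl ≫ ·) ht
      have h₂ : q ≫ t = 0 := by
        simpa [← F.map_comp_assoc] using congrArg (F.map biprod.inr ≫ ·) ht
      have h₃ : Z.f ≫ t = 0 := by rwa [← cancel_epi p, comp_zero]
      have h₄ : Z.g ≫ hZ.exact.desc t h₃ = t := hZ.exact.g_desc t h₃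
      have h₅ : hZ.exact.desc t h₃ = 0 := by
        rw [← cancel_epi e.hom, ← cancel_epi (F.map (Projective.π S)), ← Category.assoc, ← hq,
          Category.assoc, h₄, h₂]
        simp
      rw [← h₄, h₅, comp_zero]
  refine ⟨fun M => ?_⟩
  obtain ⟨P₀, _, p₀, _⟩ := hcover M
  obtain ⟨P₁, _, p₁, _⟩ := hcover (kernel p₀)
  obtain ⟨d, hd⟩ := F.map_surjective (p₁ ≫ kernel.ι p₀)
  have hw : F.map d ≫ p₀ = 0 := by simp [hd]
  have hex : (ShortComplex.mk (F.map d) p₀ hw).Exact := by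
    rw [ShortComplex.exact_iff_epi_kernel_lift]
    have : kernel.lift p₀ (F.map d) hw = p₁ := by simp [← cancel_mono (kernel.ι p₀), hd]
    rwa [this]
  exact ⟨cokernel d, ⟨PreservesCokernel.iso F d ≪≫
    (cokernelIsCokernel (F.map d)).coconePointUniqueUpToIso hex.gIsCokernel⟩⟩

end EssSurj

/-! ### Simple objects under a stable equivalence -/

section StableEquivalence

variable {C : Type u} [Category.{v} C] [Abelian C] {D : Type u'} [Category.{v'} D] [Abelian D]
  (F : C ⥤ D) [F.Additive]

/-- If `F` induces a stable equivalence and preserves simple objects, and simple objects are not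
projective, then `F` is full on simple objects. -/
theorem map_surjective_of_simple (hP : ∀ P : C, Projective P → Projective (F.obj P))
    [(stableFunctor F hP).Full] {S T : C} [Simple (F.obj S)] [Simple (F.obj T)]
    (hS : ¬ Projective (F.obj S)) : Function.Surjective (F.map (X := S) (Y := T)) := fun g => by
  obtain ⟨f, hf⟩ := exists_map_sub_factorsThroughProjective F hP g
  exact ⟨f, sub_eq_zero.1 (hf.eq_zero hS)⟩

/-- If `F` induces a stable equivalence and preserves simple objects, then every nonprojective
simple object is the image of a simple object. -/
theorem exists_iso_of_simple (hfin : ∀ X : C, IsNoetherianObject X ∧ IsArtinianObject X)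
    (hP : ∀ P : C, Projective P → Projective (F.obj P)) [(stableFunctor F hP).IsEquivalence]
    (hF : ∀ S : C, Simple S → Simple (F.obj S)) (T : D) [Simple T] (hT : ¬ Projective T) :
    ∃ S : C, Nonempty (F.obj S ≅ T) := by
  obtain ⟨X, a, b, hab, hba⟩ := exists_stable_iso F hP T
  have hX : ¬ Projective X := fun hX => hT (FactorsThroughProjective.projective (by
    have h : FactorsThroughProjective (b ≫ a) := ⟨_, hP X hX, b, a, rfl⟩
    simpa using h.add hba.neg))
  have hS : ∃ S : C, Simple S ∧ ∃ f : X ⟶ S, ¬ FactorsThroughProjective f := by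
    by_contra! h
    exact hX (projective_of_forall_simple hfin X h)
  obtain ⟨S, hS, f, hf⟩ := hS
  have := hF S hS
  -- Since `a ≫ b` is stably the identity, vanishing here would make `F.map f`, and so `f`, stably
  -- zero.
  have hbf : b ≫ F.map f ≠ 0 := fun h => hf (FactorsThroughProjective.of_map F hP (by
    have h' := (hab.postcomp (F.map f)).neg
    rwa [Preadditive.sub_comp, Category.assoc, h, comp_zero, zero_sub, neg_neg,
      Category.id_comp] at h'))
  have := isIso_of_hom_simple hbf
  exact ⟨S, ⟨(asIso (b ≫ F.map f)).symm⟩⟩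

end StableEquivalence

/-! ### Monoidal functors and invertible objects -/

section Monoidal

variable {C : Type u} [Category.{v} C] [MonoidalCategory C] [RigidCategory C]
  {D : Type u'} [Category.{v'} D] [Abelian D] [MonoidalCategory D]

/-- A monoidal functor to a category with simple unit sends invertible objects to simple ones. -/
theorem IsInvertibleObject.simple_obj {X : C} (hX : IsInvertibleObject X) (F : C ⥤ D) [F.Monoidal]
    (h : Simple (𝟙_ D)) : Simple (F.obj X) := by
  obtain ⟨Y, ⟨e⟩, ⟨e'⟩⟩ := hX.exists_iso
  exact (simple_iff_unit
    (Functor.Monoidal.μIso F X Y ≪≫ F.mapIso e ≪≫ (Functor.Monoidal.εIso F).symm)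
    (Functor.Monoidal.μIso F Y X ≪≫ F.mapIso e' ≪≫ (Functor.Monoidal.εIso F).symm)).2 h

end Monoidal

end FinTensor

end

theorem proposition1p1
    {k : Type w} [Field k] [IsAlgClosed k]
    {C : Type u} [Category.{v} C] [Abelian C] [Linear k C] [MonoidalCategory C]
    [MonoidalPreadditive C] [MonoidalLinear k C] [RigidCategory C]
    [FinTensor.IsFiniteTensorCategory k C]
    {C' : Type u'} [Category.{v'} C'] [Abelian C'] [Linear k C'] [MonoidalCategory C']
    [MonoidalPreadditive C'] [MonoidalLinear k C'] [RigidCategory C']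
    [FinTensor.IsFiniteTensorCategory k C']
    (hC : ¬ FinTensor.IsSemisimpleCategory C)
    (hC' : ¬ FinTensor.IsSemisimpleCategory C')
    (hinv : ∀ X : C, Simple X → FinTensor.IsInvertibleObject X)
    (hinv' : ∀ X : C', Simple X → FinTensor.IsInvertibleObject X)
    (F : C ⥤ C') [F.Additive] [F.Linear k] [F.Monoidal]
    [PreservesFiniteLimits F] [PreservesFiniteColimits F]
    (hF : FinTensor.InducesStableEquivalence F) :
    FinTensor.IsTensorEquivalence k F := by
  obtain ⟨hP, hequiv⟩ := hF
  have hfin := FinTensor.IsFiniteAbelian.finite_length k (C := C)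
  have hfin' := FinTensor.IsFiniteAbelian.finite_length k (C := C')
  have := FinTensor.IsFiniteAbelian.enoughProjectives k (C := C)
  have hunit := FinTensor.simple_unit hfin' hC' hinv'
  have hsimple (S : C) (hS : Simple S) : Simple (F.obj S) := (hinv S hS).simple_obj F hunit
  have hproj (T : C') (hT : Simple T) : ¬ Projective T :=
    FinTensor.not_projective_of_simple hfin' hC' hinv' T hT
  have hfull : F.Full := FinTensor.full_of_simple F hP FinTensor.injective_of_projective
    (fun _ => FinTensor.FactorsThroughProjective.of_map F hP) hfin fun S T hS hT =>
      have := hsimple S hS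
      have := hsimple T hT
      FinTensor.map_surjective_of_simple F hP (hproj _ (hsimple S hS))
  have hfaithful : F.Faithful := FinTensor.faithful_of_simple F hfin fun S hS =>
    have := hsimple S hS
    Simple.not_isZero _
  have hess : F.EssSurj := FinTensor.essSurj_of_simple F hfin' hP fun T hT =>
    FinTensor.exists_iso_of_simple F hfin hP hsimple T (hproj T hT)
  exact { full := hfull, faithful := hfaithful, essSurj := hess }
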